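/- Let $p,n,q,m,s,l$ be positive integers with $$p\ge q\ge s\ge 2,\quad 1\le n\le p,\quad 1\le m\le q,\quad 1\le l\le s,\quad p+1\le s+q,$$ $$n+m\ne q+1,\qquad n+l\ne p+1,$$ such that moreover: if $m>q+s-p$ then $n+m\neq 2q+1$ and $n+m\ne 2q-p+1$; if $l<p-s$ and $l\le p-q$ then $n+l\ne p-s+1$; if $m\le q+s-p$ then $m+l\ne s+1$. (Then $(p,n,q,m,s,l)$ is called a *3-butterfly*.) Put $t=p+q-s$, $v=q+s-p$, $w=p+s-q$, and consider labels $a_i$ $(i\in\mathbb Z/2p)$, $b_j$ $(j\in\mathbb Z/2q)$, $c_h$ $(h\in\mathbb Z/2s)$. *Canonical diagram.* Draw three disjoint segments, the bridges $a,b,c$, divided into $p$, $q$, $s$ parts. Bridge $a$ runs from the point $a_0$ to the point $a_p$; at its $i$-th division point, $0<i<p$, an underpassing strand crosses below it and joins the points $a_i$ and $a_{2p-i}$ on the two sides of the bridge. The bridges $b$ (from $b_0$ to $b_q$) and $c$ (from $c_0$ to $c_s$) are treated in the same way. Outside the bridges, join the labelled points by the pairwise disjoint arcs $a_{n-j}b_{m+j-1}$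 $(1\le j\le t)$, $b_{m-j}c_{l+j-1}$ $(1\le j\le v)$, $c_{l-j}a_{n+j-1}$ $(1\le j\le w)$. This is a link diagram; $L$ denotes the link it represents. The symbol $(p/n,q/m,s/l)$ is called a *Schubert form* if the 3-butterfly is reduced, i.e. if the diagram has no trivial component, meaning a component that runs along none of the three bridges. *Permutations.* On the set of all labels let $\gamma(a_i)=a_{2p-i}$, $\gamma(b_j)=b_{2q-j}$, $\gamma(c_h)=c_{2s-h}$, and let $\phi$ be the involution with $$a_{n-i}\leftrightarrow b_{m+i-1}\ (1\le i\le t),\qquad a_{n+j}\leftrightarrow c_{l-j-1}\ (0\le j\le w-1),\qquad b_{m-h}\leftrightarrow c_{l+h-1}\ (1\le h\le v).$$ Let $\mu=\phi\gamma$ (first $\gamma$, then $\phi$), and let $\mathcal O_\mu(x)$ be the orbit of $x$ under $\mu$. **Theorem (Classification).** Let $(p/n,q/m,s/l)$ be a Schubert form. Then: 1. $L$ is a knot (has exactly one component) if and only if $a_p\notin\mathcal O_\mu(a_0)$, $b_q\notin\mathcal O_\mu(b_0)$ and $c_s\notin\mathcal O_\mu(c_0)$. 2. $L$ is a two-component link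 if and only if exactly one of the conditions $a_p\in\mathcal O_\mu(a_0)$, $b_q\in\mathcal O_\mu(b_0)$, $c_s\in\mathcal O_\mu(c_0)$ holds. 3. $L$ is a three-component link if and only if $a_p\in\mathcal O_\mu(a_0)$, $b_q\in\mathcal O_\mu(b_0)$ and $c_s\in\mathcal O_\mu(c_0)$. -/

import Mathlib

/-- A 3-butterfly `(p, n, q, m, s, l)`.  Truncated subtraction is avoided by moving terms to the
other side: `m > q + s - p` reads `q + s < m + p`, `n + m ≠ 2q - p + 1` reads
`n + m + p ≠ 2q + 1`, and so on.  In `n_add_l_ne'` the hypothesis is `l < p - s` together with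
`l ≤ p - q`, so that the condition is the weaker one of the two variants with only one of these
inequalities. -/
structure ThreeButterfly where
  p : ℕ
  n : ℕ
  q : ℕ
  m : ℕ
  s : ℕ
  l : ℕ
  q_le_p : q ≤ p
  s_le_q : s ≤ q
  two_le_s : 2 ≤ s
  one_le_n : 1 ≤ n
  n_le_p : n ≤ p
  one_le_m : 1 ≤ m
  m_le_q : m ≤ q
  one_le_l : 1 ≤ l
  l_le_s : l ≤ s
  p_lt : p + 1 ≤ s + q
  n_add_m_ne : n + m ≠ q + 1
  n_add_l_ne : n + l ≠ p + 1
  n_add_m_ne' : q + s < m + p → n + m ≠ 2 * q + 1 ∧ n + m + p ≠ 2 * q + 1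
  n_add_l_ne' : l + s < p → l + q ≤ p → n + l + s ≠ p + 1
  m_add_l_ne : m + p ≤ q + s → m + l ≠ s + 1

/-- The names of the three bridges (and of the butterflies around them). -/
inductive Letter
  | a
  | b
  | c

namespace ThreeButterfly

variable (B : ThreeButterfly)

/-- The number of segments into which each bridge is divided: `p`, `q`, `s`. -/
def size : Letter → ℕ
  | .a => B.p
  | .b => B.q
  | .c => B.s

/-- The number `t = p + q - s` of arcs between the bridges `a` and `b`. -/
def t : ℕ := B.p + B.q - B.s

/-- The number `v = q + s - p` of arcs between the bridges `b` and `c`. -/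
def v : ℕ := B.q + B.s - B.p

/-- The number `w = p + s - q` of arcs between the bridges `c` and `a`. -/
def w : ℕ := B.p + B.s - B.q

/-- The set `A ∪ B ∪ C` of labels `a_i` (`i ∈ ℤ/2p`), `b_j` (`j ∈ ℤ/2q`), `c_h` (`h ∈ ℤ/2s`). -/
abbrev Vertex : Type := Σ k : Letter, ZMod (2 * B.size k)

/-- The label `a_i`. -/
abbrev a (i : ZMod (2 * B.p)) : B.Vertex := ⟨.a, i⟩

/-- The label `b_j`. -/
abbrev b (j : ZMod (2 * B.q)) : B.Vertex := ⟨.b, j⟩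

/-- The label `c_h`. -/
abbrev c (h : ZMod (2 * B.s)) : B.Vertex := ⟨.c, h⟩

/-! ### The canonical link diagram -/

/-- Marked points on the link drawn by the canonical diagram: the labelled points, and for each
bridge `k` its `size k + 1` division points, numbered from `0` to `size k`.  The division points
`0 < i < size k` are the crossings on the bridge `k`, where the bridge is the overpass. -/
abbrev Site : Type := B.Vertex ⊕ (Σ k : Letter, Fin (B.size k + 1))

/-- A labelled point as a point of the link. -/
abbrev label (x : B.Vertex) : B.Site := Sum.inl x

/-- The `i`-th division point of the bridge `k` as a point of the link (on the overpass). -/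
abbrev onBridge (k : Letter) (i : Fin (B.size k + 1)) : B.Site := Sum.inr ⟨k, i⟩

/-- The elementary pieces of the canonical diagram, as strands of the link.  At the crossing
in the `i`-th division point of the bridge `k` (`0 < i < size k`) the bridge runs above the
strand that joins the left point with label `i` to the right point with label
`2 * size k - i = -i`; the two strands do not meet in the link. -/
inductive Strand : B.Site → B.Site → Prop
  /-- a segment of a bridge, between consecutive division points -/
  | bridge (k : Letter) (i : Fin (B.size k)) :
      Strand (B.onBridge k i.castSucc) (B.onBridge k i.succ)
  /-- the bridge begins in the point with label `0` -/
  | bridgeStart (k : Letter) : Strand (B.label ⟨k, 0⟩) (B.onBridge k 0)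
  /-- the bridge ends in the point with label `size k` -/
  | bridgeEnd (k : Letter) :
      Strand (B.label ⟨k, (B.size k : ZMod (2 * B.size k))⟩) (B.onBridge k (Fin.last (B.size k)))
  /-- the underpass in the `i`-th crossing of a bridge -/
  | under (k : Letter) (i : ℕ) (h0 : 0 < i) (h1 : i < B.size k) :
      Strand (B.label ⟨k, (i : ZMod (2 * B.size k))⟩)
        (B.label ⟨k, ((2 * B.size k - i : ℕ) : ZMod (2 * B.size k))⟩)
  /-- the arcs `a_{n-j} b_{m+j-1}` -/
  | arcAB (j : ℕ) (h0 : 1 ≤ j) (h1 : j ≤ B.t) :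
      Strand (B.label (B.a (B.n - j))) (B.label (B.b (B.m + j - 1)))
  /-- the arcs `b_{m-j} c_{l+j-1}` -/
  | arcBC (j : ℕ) (h0 : 1 ≤ j) (h1 : j ≤ B.v) :
      Strand (B.label (B.b (B.m - j))) (B.label (B.c (B.l + j - 1)))
  /-- the arcs `c_{l-j} a_{n+j-1}` -/
  | arcCA (j : ℕ) (h0 : 1 ≤ j) (h1 : j ≤ B.w) :
      Strand (B.label (B.c (B.l - j))) (B.label (B.a (B.n + j - 1)))

/-- The link drawn by the canonical diagram, as a graph: a disjoint union of closed curves, each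
subdivided by its marked points. -/
def link : SimpleGraph B.Site := SimpleGraph.fromRel B.Strand

/-- The number of components of the link. -/
noncomputable def numComponents : ℕ := Nat.card B.link.ConnectedComponent

/-- `(p/n, q/m, s/l)` is a Schubert form: the butterfly is reduced, i.e. no component of its diagram is a trivial component, that is, a closed
curve which runs along no bridge (and so lies below the rest of the diagram). -/
def IsSchubertForm : Prop :=
  ∀ K : B.link.ConnectedComponent, ∃ k i, B.link.connectedComponentMk (B.onBridge k i) = K

/-! ### The permutations `γ`, `φ` and `μ` -/

/-- The reflection `γ` along the bridges: `a_i ↦ a_{2p-i}`, `b_j ↦ b_{2q-j}`, `c_h ↦ c_{2s-h}`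
(the subscripts are residues, so that `2p - i = -i`). -/
def gamma : Equiv.Perm B.Vertex where
  toFun x := ⟨x.1, -x.2⟩
  invFun x := ⟨x.1, -x.2⟩
  left_inv x := by simp
  right_inv x := by simp

/-- The values `φ(a_x)`. -/
def phiA (x : ZMod (2 * B.p)) : B.Vertex :=
  if (x - B.n).val < B.w then B.c (B.l - (x - B.n).val - 1)
  else B.b (B.m + (2 * B.p - (x - B.n).val : ℕ) - 1)

/-- The values `φ(b_x)`. -/
def phiB (x : ZMod (2 * B.q)) : B.Vertex :=
  if (x - B.m).val < B.t then B.a (B.n - (x - B.m).val - 1)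
  else B.c (B.l + (2 * B.q - (x - B.m).val : ℕ) - 1)

/-- The values `φ(c_x)`. -/
def phiC (x : ZMod (2 * B.s)) : B.Vertex :=
  if (x - B.l).val < B.v then B.b (B.m - (x - B.l).val - 1)
  else B.a (B.n + (2 * B.s - (x - B.l).val : ℕ) - 1)

/-- The function underlying `φ`; the facts `phi_a_sub`, `phi_a_add` and `phi_b_sub` below are the
rules that define it. -/
def phiFun : B.Vertex → B.Vertex
  | ⟨.a, x⟩ => B.phiA x
  | ⟨.b, x⟩ => B.phiB x
  | ⟨.c, x⟩ => B.phiC x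

theorem val_neg_natCast {N i : ℕ} (h0 : 1 ≤ i) (h1 : i ≤ N) :
    ((-(i : ZMod N)).val) = N - i := by
  have h : (-(i : ZMod N)) = ((N - i : ℕ) : ZMod N) := by
    rw [Nat.cast_sub h1, ZMod.natCast_self, zero_sub]
  rw [h, ZMod.val_cast_of_lt (by omega)]

/-- Every residue mod `N` is `y + j` with `0 ≤ j < k` or `y - i` with `1 ≤ i ≤ N - k`. -/
theorem residue_cases {N : ℕ} (hN : 0 < N) (k : ℕ) (x y : ZMod N) :
    (∃ j : ℕ, j < k ∧ j < N ∧ x = y + j) ∨ (∃ i : ℕ, 1 ≤ i ∧ i + k ≤ N ∧ x = y - i) := by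
  have : NeZero N := ⟨hN.ne'⟩
  have hv : (x - y).val < N := ZMod.val_lt _
  have hx : x = y + ((x - y).val : ZMod N) := by
    rw [ZMod.natCast_zmod_val]; ring
  by_cases h : (x - y).val < k
  · exact Or.inl ⟨_, h, hv, hx⟩
  · refine Or.inr ⟨N - (x - y).val, by omega, by omega, ?_⟩
    rw [Nat.cast_sub hv.le, ZMod.natCast_self]
    nth_rewrite 1 [hx]
    ring

theorem phiFun_a_sub (i : ℕ) (h0 : 1 ≤ i) (h1 : i ≤ B.t) :
    B.phiFun (B.a (B.n - i)) = B.b (B.m + i - 1) := by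
  have := B.q_le_p; have := B.s_le_q; have := B.p_lt
  unfold t at h1
  have hv : ((B.n : ZMod (2 * B.p)) - i - B.n).val = 2 * B.p - i := by
    rw [show (B.n : ZMod (2 * B.p)) - i - B.n = -(i : ZMod (2 * B.p)) by ring]
    exact val_neg_natCast h0 (by omega)
  show B.phiA _ = _
  unfold phiA
  rw [hv, if_neg (by unfold w; omega), show 2 * B.p - (2 * B.p - i) = i by omega]

theorem phiFun_a_add (j : ℕ) (h : j < B.w) :
    B.phiFun (B.a (B.n + j)) = B.c (B.l - j - 1) := by
  have := B.q_le_p; have := B.s_le_q; have := B.p_lt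
  have hv : ((B.n : ZMod (2 * B.p)) + j - B.n).val = j := by
    rw [add_sub_cancel_left]
    exact ZMod.val_cast_of_lt (by unfold w at h; omega)
  show B.phiA _ = _
  unfold phiA
  rw [hv, if_pos h]

theorem phiFun_b_sub (h : ℕ) (h0 : 1 ≤ h) (h1 : h ≤ B.v) :
    B.phiFun (B.b (B.m - h)) = B.c (B.l + h - 1) := by
  have := B.q_le_p; have := B.s_le_q; have := B.p_lt
  unfold v at h1
  have hv : ((B.m : ZMod (2 * B.q)) - h - B.m).val = 2 * B.q - h := by
    rw [show (B.m : ZMod (2 * B.q)) - h - B.m = -(h : ZMod (2 * B.q)) by ring]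
    exact val_neg_natCast h0 (by omega)
  show B.phiB _ = _
  unfold phiB
  rw [hv, if_neg (by unfold t; omega), show 2 * B.q - (2 * B.q - h) = h by omega]

theorem phiFun_b_add (j : ℕ) (h : j < B.t) :
    B.phiFun (B.b (B.m + j)) = B.a (B.n - j - 1) := by
  have := B.q_le_p; have := B.s_le_q; have := B.p_lt
  have hv : ((B.m : ZMod (2 * B.q)) + j - B.m).val = j := by
    rw [add_sub_cancel_left]
    exact ZMod.val_cast_of_lt (by unfold t at h; omega)
  show B.phiB _ = _
  unfold phiB
  rw [hv, if_pos h]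

theorem phiFun_c_sub (i : ℕ) (h0 : 1 ≤ i) (h1 : i ≤ B.w) :
    B.phiFun (B.c (B.l - i)) = B.a (B.n + i - 1) := by
  have := B.q_le_p; have := B.s_le_q; have := B.p_lt
  unfold w at h1
  have hv : ((B.l : ZMod (2 * B.s)) - i - B.l).val = 2 * B.s - i := by
    rw [show (B.l : ZMod (2 * B.s)) - i - B.l = -(i : ZMod (2 * B.s)) by ring]
    exact val_neg_natCast h0 (by omega)
  show B.phiC _ = _
  unfold phiC
  rw [hv, if_neg (by unfold v; omega), show 2 * B.s - (2 * B.s - i) = i by omega]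

theorem phiFun_c_add (j : ℕ) (h : j < B.v) :
    B.phiFun (B.c (B.l + j)) = B.b (B.m - j - 1) := by
  have := B.q_le_p; have := B.s_le_q; have := B.p_lt
  have hv : ((B.l : ZMod (2 * B.s)) + j - B.l).val = j := by
    rw [add_sub_cancel_left]
    exact ZMod.val_cast_of_lt (by unfold v at h; omega)
  show B.phiC _ = _
  unfold phiC
  rw [hv, if_pos h]

theorem phiFun_involutive : Function.Involutive B.phiFun := by
  have h1 := B.q_le_p
  have h2 := B.s_le_q
  have h3 := B.p_lt
  have h4 := B.two_le_s
  rintro ⟨k, x⟩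
  cases k with
  | a =>
    change ZMod (2 * B.p) at x
    rcases residue_cases (by omega) B.w x B.n with ⟨j, hj, -, rfl⟩ | ⟨i, hi, hi', rfl⟩
    · rw [B.phiFun_a_add j hj]
      have := B.phiFun_c_sub (j + 1) (by omega) (by omega)
      push_cast at this
      rw [← sub_sub, ← add_assoc, add_sub_cancel_right] at this
      exact this
    · have hi'' : i ≤ B.t := by unfold w at hi'; unfold t; omega
      rw [B.phiFun_a_sub i hi hi'']
      obtain ⟨j, rfl⟩ : ∃ j, i = j + 1 := ⟨i - 1, by omega⟩
      have := B.phiFun_b_add j (by omega)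
      push_cast
      rw [← sub_sub, ← add_assoc, add_sub_cancel_right]
      exact this
  | b =>
    change ZMod (2 * B.q) at x
    rcases residue_cases (by omega) B.t x B.m with ⟨j, hj, -, rfl⟩ | ⟨i, hi, hi', rfl⟩
    · rw [B.phiFun_b_add j hj]
      have := B.phiFun_a_sub (j + 1) (by omega) (by omega)
      push_cast at this
      rw [← sub_sub, ← add_assoc, add_sub_cancel_right] at this
      exact this
    · have hi'' : i ≤ B.v := by unfold t at hi'; unfold v; omega
      rw [B.phiFun_b_sub i hi hi'']
      obtain ⟨j, rfl⟩ : ∃ j, i = j + 1 := ⟨i - 1, by omega⟩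
      have := B.phiFun_c_add j (by omega)
      push_cast
      rw [← sub_sub, ← add_assoc, add_sub_cancel_right]
      exact this
  | c =>
    change ZMod (2 * B.s) at x
    rcases residue_cases (by omega) B.v x B.l with ⟨j, hj, -, rfl⟩ | ⟨i, hi, hi', rfl⟩
    · rw [B.phiFun_c_add j hj]
      have := B.phiFun_b_sub (j + 1) (by omega) (by omega)
      push_cast at this
      rw [← sub_sub, ← add_assoc, add_sub_cancel_right] at this
      exact this
    · have hi'' : i ≤ B.w := by unfold v at hi'; unfold w; omega
      rw [B.phiFun_c_sub i hi hi'']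
      obtain ⟨j, rfl⟩ : ∃ j, i = j + 1 := ⟨i - 1, by omega⟩
      have := B.phiFun_a_add j (by omega)
      push_cast
      rw [← sub_sub, ← add_assoc, add_sub_cancel_right]
      exact this

/-- The permutation `φ`, of order two. -/
def phi : Equiv.Perm B.Vertex := B.phiFun_involutive.toPerm

/-- `a_{n-i} ↔ b_{m+i-1}` for `1 ≤ i ≤ t`. -/
theorem phi_a_sub (i : ℕ) (h0 : 1 ≤ i) (h1 : i ≤ B.t) :
    B.phi (B.a (B.n - i)) = B.b (B.m + i - 1) ∧ B.phi (B.b (B.m + i - 1)) = B.a (B.n - i) := by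
  have h := B.phiFun_a_sub i h0 h1
  exact ⟨h, by rw [← h]; exact B.phiFun_involutive _⟩

/-- `a_{n+j} ↔ c_{l-j-1}` for `0 ≤ j ≤ w - 1`. -/
theorem phi_a_add (j : ℕ) (h : j < B.w) :
    B.phi (B.a (B.n + j)) = B.c (B.l - j - 1) ∧ B.phi (B.c (B.l - j - 1)) = B.a (B.n + j) := by
  have h := B.phiFun_a_add j h
  exact ⟨h, by rw [← h]; exact B.phiFun_involutive _⟩

/-- `b_{m-h} ↔ c_{l+h-1}` for `1 ≤ h ≤ v`. -/
theorem phi_b_sub (h : ℕ) (h0 : 1 ≤ h) (h1 : h ≤ B.v) :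
    B.phi (B.b (B.m - h)) = B.c (B.l + h - 1) ∧ B.phi (B.c (B.l + h - 1)) = B.b (B.m - h) := by
  have h' := B.phiFun_b_sub h h0 h1
  exact ⟨h', by rw [← h']; exact B.phiFun_involutive _⟩

/-- The permutation `μ = φγ`, which applies `γ` first. -/
def mu : Equiv.Perm B.Vertex := B.phi * B.gamma

/-- The orbit of `x` under `μ`. -/
def orbitMu (x : B.Vertex) : Set B.Vertex := MulAction.orbit (Subgroup.zpowers B.mu) x

end ThreeButterfly

/-! Along the link, a label continues through an underpass (`γ`) or along an outer arc (`φ`). Both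
are involutions; `φ` has no fixed point, and `γ` fixes exactly the six bridge ends. The orbit under
`μ = φγ` of a bridge end is stable under `γ` and `φ` and contains exactly two fixed points of `γ`
(`exists_fixed_mem_orbit`, `fixed_eq_of_mem_orbit`): alternating arcs and underpasses leads from one
bridge end to exactly one other.

If the ends of the bridge `k` are paired this way, the bridge closes up by itself; otherwise its
start is paired with an end of another bridge. So `finish k` lies in the orbit of `start k` iff no
other bridge shares the component of `k` (`finish_mem_orbitMu_iff`). In a Schubert form every
component meets a bridge, so it remains to count the distinct values among three bridge components.
-/

namespace Equiv.Perm

/-! ### Fixed points in the orbits of a product of two involutions -/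

/-- An involution `g` inverts the product of `g` with another involution. -/
theorem apply_zpow_mul_of_involutive {X : Type*} {g f : Equiv.Perm X}
    (hg : ∀ x, g (g x) = x) (hf : ∀ x, f (f x) = x) {x : X} (hx : g x = x) (i : ℤ) :
    g (((f * g) ^ i) x) = ((f * g) ^ (-i)) x := by
  have hg' : g⁻¹ = g := inv_eq_of_mul_eq_one_left (Equiv.ext hg)
  have hf' : f⁻¹ = f := inv_eq_of_mul_eq_one_left (Equiv.ext hf)
  have h : g * (f * g) * g⁻¹ = (f * g)⁻¹ := by
    rw [mul_inv_rev, hf', hg']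
    ext y
    simp [hg]
  have h2 : g * (f * g) ^ i * g⁻¹ = (f * g) ^ (-i) := by
    rw [← conj_zpow, h, inv_zpow, zpow_neg]
  rw [← h2, Equiv.Perm.mul_apply, Equiv.Perm.mul_apply, hg', hx]

theorem zpow_apply_eq_self_iff {X : Type*} (m : Equiv.Perm X) (x : X) (i : ℤ) :
    (m ^ i) x = x ↔ (Function.minimalPeriod m x : ℤ) ∣ i :=
  MulAction.zpow_smul_eq_iff_minimalPeriod_dvd (a := m) (b := x) (n := i)

/-- Since `g` maps the `i`-th iterate to the `(-i)`-th, being fixed means that `2 * i` steps return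
to `x`. Hence `g` can fix only `x` and the point half a period away. -/
theorem apply_zpow_mul_eq_iff {X : Type*} {g f : Equiv.Perm X}
    (hg : ∀ x, g (g x) = x) (hf : ∀ x, f (f x) = x) {x : X} (hx : g x = x) (i : ℤ) :
    g (((f * g) ^ i) x) = ((f * g) ^ i) x ↔
      (Function.minimalPeriod (f * g) x : ℤ) ∣ 2 * i := by
  rw [apply_zpow_mul_of_involutive hg hf hx, ← zpow_apply_eq_self_iff,
    ← (Equiv.injective ((f * g) ^ i)).eq_iff, ← Equiv.Perm.mul_apply, ← Equiv.Perm.mul_apply,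
    ← zpow_add, ← zpow_add, add_neg_cancel, ← two_mul, zpow_zero, Equiv.Perm.one_apply, eq_comm]

/-- Besides a fixed point `x` of the involution `g`, the orbit of `x` under `f * g` contains at
most one fixed point of `g`. -/
theorem fixed_eq_of_mem_orbit {X : Type*} {g f : Equiv.Perm X}
    (hg : ∀ x, g (g x) = x) (hf : ∀ x, f (f x) = x) {x y z : X} (hx : g x = x)
    (hy : ∃ i : ℤ, ((f * g) ^ i) x = y) (hz : ∃ i : ℤ, ((f * g) ^ i) x = z)
    (hgy : g y = y) (hgz : g z = z) (hyx : y ≠ x) (hzx : z ≠ x) : y = z := by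
  obtain ⟨i, rfl⟩ := hy
  obtain ⟨j, rfl⟩ := hz
  rw [apply_zpow_mul_eq_iff hg hf hx] at hgy hgz
  rw [Ne, zpow_apply_eq_self_iff] at hyx hzx
  obtain ⟨c, hc⟩ := hgy
  obtain ⟨d, hd⟩ := hgz
  -- Fixed points other than `x` sit at odd multiples of half the period, so `i` and `j` differ by a
  -- multiple of the whole period.
  have odd_of : ∀ {i c : ℤ}, 2 * i = Function.minimalPeriod (f * g) x * c →
      ¬ (Function.minimalPeriod (f * g) x : ℤ) ∣ i → Odd c := by
    intro i c h hn
    by_contra h'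
    obtain ⟨e, rfl⟩ := Int.not_odd_iff_even.mp h'
    exact hn ⟨e, by linarith⟩
  obtain ⟨e, he⟩ := (odd_of hc hyx).sub_odd (odd_of hd hzx)
  have hdvd : (Function.minimalPeriod (f * g) x : ℤ) ∣ -j + i :=
    ⟨e, by
      refine mul_left_cancel₀ (two_ne_zero' ℤ) ?_
      linear_combination hc - hd + Function.minimalPeriod (f * g) x * he⟩
  rw [← zpow_apply_eq_self_iff, zpow_add, Equiv.Perm.mul_apply, zpow_neg,
    Equiv.Perm.inv_eq_iff_eq] at hdvd
  exact hdvd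

/-- If `f` has no fixed points, the orbit under `f * g` of a fixed point of `g` contains a second
one. -/
theorem exists_fixed_mem_orbit {X : Type*} [Finite X] {g f : Equiv.Perm X}
    (hg : ∀ x, g (g x) = x) (hf : ∀ x, f (f x) = x) (hf' : ∀ x, f x ≠ x) {x : X} (hx : g x = x) :
    ∃ i : ℤ, ((f * g) ^ i) x ≠ x ∧ g (((f * g) ^ i) x) = ((f * g) ^ i) x := by
  have hpos : 0 < Function.minimalPeriod (f * g) x :=
    Function.minimalPeriod_pos_of_mem_periodicPts
      ((f * g).injective.mem_periodicPts x)
  rcases Nat.even_or_odd' (Function.minimalPeriod (f * g) x) with ⟨r, hr | hr⟩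
  · refine ⟨r, ?_, ?_⟩
    · rw [Ne, zpow_apply_eq_self_iff, Int.natCast_dvd_natCast]
      intro h
      have := Nat.le_of_dvd (by omega) h
      omega
    · rw [apply_zpow_mul_eq_iff hg hf hx, hr]
      push_cast
      exact dvd_rfl
  -- With odd period `2r + 1`, `f` sends the iterate `-r` to `r + 1`, which is the same point: a
  -- fixed point of `f`.
  · exfalso
    refine hf' (((f * g) ^ (-(r : ℤ))) x) ?_
    have h1 : f (((f * g) ^ (-(r : ℤ))) x) = ((f * g) ^ (1 + (r : ℤ))) x := by
      have h := apply_zpow_mul_of_involutive hg hf hx (r : ℤ)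
      rw [← h, zpow_add, zpow_one]
      rfl
    have h2 : ((f * g) ^ ((2 * r + 1 : ℕ) : ℤ)) x = x := by
      rw [zpow_apply_eq_self_iff, hr]
    rw [h1]
    nth_rewrite 2 [← h2]
    rw [← Equiv.Perm.mul_apply, ← zpow_add]
    congr 2
    push_cast
    ring

end Equiv.Perm

/-! ### Bridge ends as fixed points of `γ`, and orbits of `μ` -/

namespace ThreeButterfly

variable (B : ThreeButterfly)

theorem size_pos (k : Letter) : 0 < B.size k := by
  have h1 := B.q_le_p
  have h2 := B.s_le_q
  have h4 := B.two_le_s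
  cases k <;> simp only [size] <;> omega

instance instFiniteVertex : Finite B.Vertex := by
  have : Finite Letter :=
    Finite.of_surjective (fun i : Fin 3 => ![Letter.a, Letter.b, Letter.c] i)
      fun k => by cases k; exacts [⟨0, rfl⟩, ⟨1, rfl⟩, ⟨2, rfl⟩]
  have : ∀ k, NeZero (2 * B.size k) := fun k => ⟨by have := B.size_pos k; omega⟩
  infer_instance

/-- The end `k_0` of the bridge `k`. -/
abbrev start (k : Letter) : B.Vertex := ⟨k, 0⟩

/-- The end of the bridge `k` with label `size k`. -/
abbrev finish (k : Letter) : B.Vertex := ⟨k, (B.size k : ZMod (2 * B.size k))⟩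

theorem natCast_size_ne_zero (k : Letter) : (B.size k : ZMod (2 * B.size k)) ≠ 0 := by
  have := B.size_pos k
  rw [Ne, ZMod.natCast_eq_zero_iff]
  intro h
  have := Nat.le_of_dvd this h
  omega

theorem natCast_two_size_sub (k : Letter) {i : ℕ} (h : i ≤ 2 * B.size k) :
    ((2 * B.size k - i : ℕ) : ZMod (2 * B.size k)) = -i := by
  rw [Nat.cast_sub h, ZMod.natCast_self, zero_sub]

/-- Every label is an end of its bridge, or lies on the first side, or on the second side. -/
theorem vertex_cases (x : B.Vertex) :
    x = B.start x.1 ∨ x = B.finish x.1 ∨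
      (∃ i : ℕ, 0 < i ∧ i < B.size x.1 ∧ x = ⟨x.1, i⟩) ∨
      ∃ i : ℕ, 0 < i ∧ i < B.size x.1 ∧ x = ⟨x.1, -i⟩ := by
  obtain ⟨k, x⟩ := x
  have hk := B.size_pos k
  have : NeZero (2 * B.size k) := ⟨by omega⟩
  have hlt := ZMod.val_lt x
  have hx := ZMod.natCast_zmod_val x
  dsimp only
  generalize x.val = j at hlt hx
  subst hx
  rcases Nat.lt_trichotomy j (B.size k) with h | h | h
  · rcases Nat.eq_zero_or_pos j with h0 | h0
    · left; simp [h0]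
    · exact Or.inr (Or.inr (Or.inl ⟨j, h0, h, rfl⟩))
  · right; left; simp [h]
  · refine Or.inr (Or.inr (Or.inr ⟨2 * B.size k - j, by omega, by omega, ?_⟩))
    rw [B.natCast_two_size_sub k hlt.le, neg_neg]

theorem gamma_start (k : Letter) : B.gamma (B.start k) = B.start k := by
  simp [gamma]

theorem gamma_finish (k : Letter) : B.gamma (B.finish k) = B.finish k := by
  have h := B.natCast_two_size_sub k (i := B.size k) (by omega)
  rw [show 2 * B.size k - B.size k = B.size k by omega] at h
  exact congrArg (Sigma.mk k) h.symm

theorem gamma_gamma (x : B.Vertex) : B.gamma (B.gamma x) = x := by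
  simp [gamma]

theorem gamma_eq_self {x : B.Vertex} (h : B.gamma x = x) :
    x = B.start x.1 ∨ x = B.finish x.1 := by
  -- A fixed residue would satisfy `2 * i = 0`, but `0 < 2 * i < 2 * size`.
  have key : ∀ i : ℕ, 0 < i → i < B.size x.1 →
      (-(i : ZMod (2 * B.size x.1))) ≠ i := by
    intro i h0 h1 h2
    have h3 : ((2 * i : ℕ) : ZMod (2 * B.size x.1)) = 0 := by
      push_cast
      linear_combination -h2
    rw [ZMod.natCast_eq_zero_iff] at h3
    have := Nat.le_of_dvd (by omega) h3
    omega
  obtain ⟨k, x⟩ := x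
  have hx : -x = x := eq_of_heq (Sigma.mk.inj h).2
  rcases B.vertex_cases ⟨k, x⟩ with h | h | ⟨i, h0, h1, h⟩ | ⟨i, h0, h1, h⟩
  · exact Or.inl h
  · exact Or.inr h
  · obtain rfl : x = i := eq_of_heq (Sigma.mk.inj h).2
    exact (key i h0 h1 hx).elim
  · obtain rfl : x = -i := eq_of_heq (Sigma.mk.inj h).2
    exact (key i h0 h1 (by rw [neg_neg] at hx; exact hx.symm)).elim

theorem phi_phi (x : B.Vertex) : B.phi (B.phi x) = x := B.phiFun_involutive x

/-- Every outer arc leads to a different bridge, so `φ` changes the letter. -/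
theorem phi_ne_self (x : B.Vertex) : B.phi x ≠ x := by
  intro h
  have h' : (B.phiFun x).1 = x.1 := congrArg Sigma.fst h
  obtain ⟨k, x⟩ := x
  cases k <;> simp only [phiFun, phiA, phiB, phiC] at h' <;> split_ifs at h'

theorem mem_orbitMu {x y : B.Vertex} : y ∈ B.orbitMu x ↔ ∃ i : ℤ, (B.mu ^ i) x = y := by
  unfold orbitMu
  rw [MulAction.mem_orbit_iff]
  constructor
  · rintro ⟨⟨_, i, rfl⟩, h⟩
    exact ⟨i, h⟩
  · rintro ⟨i, h⟩
    exact ⟨⟨_, i, rfl⟩, h⟩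

/-- The base point must be fixed by `γ`: then inverting `μ` only reverses the orbit. -/
theorem gamma_mem_orbitMu {x y : B.Vertex} (hx : B.gamma x = x) :
    B.gamma y ∈ B.orbitMu x ↔ y ∈ B.orbitMu x := by
  have key : ∀ y, y ∈ B.orbitMu x → B.gamma y ∈ B.orbitMu x := by
    intro y hy
    obtain ⟨i, rfl⟩ := B.mem_orbitMu.1 hy
    exact B.mem_orbitMu.2
      ⟨-i, (Equiv.Perm.apply_zpow_mul_of_involutive B.gamma_gamma B.phi_phi hx i).symm⟩
  exact ⟨fun h => by simpa only [gamma_gamma] using key _ h, key y⟩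

theorem phi_mem_orbitMu {x y : B.Vertex} (hx : B.gamma x = x) :
    B.phi y ∈ B.orbitMu x ↔ y ∈ B.orbitMu x := by
  have key : ∀ y, y ∈ B.orbitMu x → B.phi y ∈ B.orbitMu x := by
    intro y hy
    obtain ⟨i, hi⟩ := B.mem_orbitMu.1 ((B.gamma_mem_orbitMu hx).2 hy)
    -- Here `φ y = μ (γ y)`, hence one step more than for `γ y`.
    refine B.mem_orbitMu.2 ⟨1 + i, ?_⟩
    rw [zpow_add, zpow_one, Equiv.Perm.mul_apply, hi]
    exact congrArg B.phi (B.gamma_gamma y)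
  exact ⟨fun h => by simpa only [phi_phi] using key _ h, key y⟩

/-! ### Components of the link -/

theorem Strand.connectedComponentMk_eq {B : ThreeButterfly} {x y : B.Site} (h : B.Strand x y) :
    B.link.connectedComponentMk x = B.link.connectedComponentMk y := by
  by_cases hxy : x = y
  · rw [hxy]
  · exact SimpleGraph.ConnectedComponent.sound
      (SimpleGraph.Adj.reachable ((SimpleGraph.fromRel_adj _ _ _).2 ⟨hxy, Or.inl h⟩))

/-- The component of the link through the bridge `k`. -/
def bridgeComponent (k : Letter) : B.link.ConnectedComponent :=
  B.link.connectedComponentMk (B.onBridge k 0)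

theorem onBridge_component (k : Letter) (i : Fin (B.size k + 1)) :
    B.link.connectedComponentMk (B.onBridge k i) = B.bridgeComponent k := by
  induction i using Fin.induction with
  | zero => rfl
  | succ i ih => rw [← ih]; exact (Strand.bridge k i).connectedComponentMk_eq.symm

theorem start_component (k : Letter) :
    B.link.connectedComponentMk (B.label (B.start k)) = B.bridgeComponent k :=
  (Strand.bridgeStart k).connectedComponentMk_eq

theorem finish_component (k : Letter) :
    B.link.connectedComponentMk (B.label (B.finish k)) = B.bridgeComponent k :=
  (Strand.bridgeEnd k).connectedComponentMk_eq.trans (B.onBridge_component k _)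

/-- Off the bridge ends `γ` exchanges the two ends of an underpass. -/
theorem gamma_component (x : B.Vertex) :
    B.link.connectedComponentMk (B.label (B.gamma x)) =
      B.link.connectedComponentMk (B.label x) := by
  have key : ∀ (k : Letter) (i : ℕ), 0 < i → i < B.size k →
      B.link.connectedComponentMk (B.label ⟨k, -i⟩) =
        B.link.connectedComponentMk (B.label ⟨k, i⟩) := by
    intro k i h0 h1
    rw [← B.natCast_two_size_sub k (i := i) (by omega)]
    exact (Strand.under k i h0 h1).connectedComponentMk_eq.symm
  rcases B.vertex_cases x with h | h | ⟨i, h0, h1, h⟩ | ⟨i, h0, h1, h⟩ <;>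
    generalize x.1 = k at * <;> subst h
  · rw [gamma_start]
  · rw [gamma_finish]
  · exact key _ i h0 h1
  · have : B.gamma ⟨k, -i⟩ = ⟨k, i⟩ := congrArg (Sigma.mk k) (neg_neg _)
    rw [this]
    exact (key _ i h0 h1).symm

theorem phi_component (x : B.Vertex) :
    B.link.connectedComponentMk (B.label (B.phi x)) =
      B.link.connectedComponentMk (B.label x) := by
  have h1 := B.q_le_p
  have h2 := B.s_le_q
  have h3 := B.p_lt
  have h4 := B.two_le_s
  have hab : ∀ i : ℕ, 1 ≤ i → i ≤ B.t →
      B.link.connectedComponentMk (B.label (B.phi (B.a (B.n - i)))) =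
        B.link.connectedComponentMk (B.label (B.a (B.n - i))) := by
    intro i hi hi'
    rw [(B.phi_a_sub i hi hi').1]
    exact (Strand.arcAB i hi hi').connectedComponentMk_eq.symm
  have hbc : ∀ i : ℕ, 1 ≤ i → i ≤ B.v →
      B.link.connectedComponentMk (B.label (B.phi (B.b (B.m - i)))) =
        B.link.connectedComponentMk (B.label (B.b (B.m - i))) := by
    intro i hi hi'
    rw [(B.phi_b_sub i hi hi').1]
    exact (Strand.arcBC i hi hi').connectedComponentMk_eq.symm
  have hca : ∀ i : ℕ, 1 ≤ i → i ≤ B.w →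
      B.link.connectedComponentMk (B.label (B.phi (B.c (B.l - i)))) =
        B.link.connectedComponentMk (B.label (B.c (B.l - i))) := by
    intro i hi hi'
    have : B.phi (B.c (B.l - i)) = B.a (B.n + i - 1) := B.phiFun_c_sub i hi hi'
    rw [this]
    exact (Strand.arcCA i hi hi').connectedComponentMk_eq.symm
  -- Each arc is handled from one end only; the involution transfers the claim to the other end.
  have swap : ∀ y, B.link.connectedComponentMk (B.label (B.phi (B.phi y))) =
      B.link.connectedComponentMk (B.label (B.phi y)) →
      B.link.connectedComponentMk (B.label (B.phi y)) =
        B.link.connectedComponentMk (B.label y) := by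
    intro y h
    rw [phi_phi] at h
    exact h.symm
  obtain ⟨k, x⟩ := x
  cases k with
  | a =>
    change ZMod (2 * B.p) at x
    rcases residue_cases (by omega) B.w x B.n with ⟨j, hj, -, rfl⟩ | ⟨i, hi, hi', rfl⟩
    · apply swap
      have := hca (j + 1) (by omega) (by omega)
      push_cast at this
      rw [← sub_sub] at this
      rw [(B.phi_a_add j hj).1]
      exact this
    · exact hab i hi (by unfold w at hi'; unfold t; omega)
  | b =>
    change ZMod (2 * B.q) at x
    rcases residue_cases (by omega) B.t x B.m with ⟨j, hj, -, rfl⟩ | ⟨i, hi, hi', rfl⟩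
    · apply swap
      have := hab (j + 1) (by omega) (by omega)
      push_cast at this
      rw [← sub_sub] at this
      have h : B.phi (B.b (B.m + j)) = _ := B.phiFun_b_add j hj
      rw [h]
      exact this
    · exact hbc i hi (by unfold t at hi'; unfold v; omega)
  | c =>
    change ZMod (2 * B.s) at x
    rcases residue_cases (by omega) B.v x B.l with ⟨j, hj, -, rfl⟩ | ⟨i, hi, hi', rfl⟩
    · apply swap
      have := hbc (j + 1) (by omega) (by omega)
      push_cast at this
      rw [← sub_sub] at this
      have h : B.phi (B.c (B.l + j)) = _ := B.phiFun_c_add j hj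
      rw [h]
      exact this
    · exact hca i hi (by unfold v at hi'; unfold w; omega)

theorem orbitMu_component {x y : B.Vertex} (h : y ∈ B.orbitMu x) :
    B.link.connectedComponentMk (B.label y) = B.link.connectedComponentMk (B.label x) := by
  have hmu : ∀ z, B.link.connectedComponentMk (B.label (B.mu z)) =
      B.link.connectedComponentMk (B.label z) := fun z =>
    (B.phi_component _).trans (B.gamma_component z)
  obtain ⟨i, rfl⟩ := B.mem_orbitMu.1 h
  induction i with
  | zero => simp
  | succ i ih =>
    rw [← ih (B.mem_orbitMu.2 ⟨_, rfl⟩), add_comm, zpow_add, zpow_one, Equiv.Perm.mul_apply, hmu]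
  | pred i ih =>
    rw [← ih (B.mem_orbitMu.2 ⟨_, rfl⟩), ← hmu, ← Equiv.Perm.mul_apply, ← zpow_one_add]
    congr 4
    ring

/-! ### Bridges sharing a component -/

theorem start_mem_orbitMu (k : Letter) : B.start k ∈ B.orbitMu (B.start k) :=
  B.mem_orbitMu.2 ⟨0, rfl⟩

theorem start_ne_finish (k j : Letter) : B.start j ≠ B.finish k := by
  intro h
  obtain rfl : j = k := congrArg Sigma.fst h
  exact B.natCast_size_ne_zero j (eq_of_heq (Sigma.mk.inj h).2).symm

/-- A bridge whose ends are not joined below the other bridges lies on a component that also runs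
along another bridge. -/
theorem exists_bridgeComponent_eq {k : Letter} (h : B.finish k ∉ B.orbitMu (B.start k)) :
    ∃ j, j ≠ k ∧ B.bridgeComponent j = B.bridgeComponent k := by
  obtain ⟨i, hne, hfix⟩ := Equiv.Perm.exists_fixed_mem_orbit B.gamma_gamma B.phi_phi
    B.phi_ne_self (B.gamma_start k)
  have hmem : (B.mu ^ i) (B.start k) ∈ B.orbitMu (B.start k) := B.mem_orbitMu.2 ⟨i, rfl⟩
  have hcomp := B.orbitMu_component hmem
  rw [start_component] at hcomp
  change (B.mu ^ i) (B.start k) ≠ _ at hne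
  change B.gamma ((B.mu ^ i) (B.start k)) = (B.mu ^ i) (B.start k) at hfix
  generalize (B.mu ^ i) (B.start k) = y at *
  rcases B.gamma_eq_self hfix with hy | hy <;> generalize y.1 = j at hy <;> subst hy
  · exact ⟨j, fun hj => hne (by rw [hj]), by rw [← hcomp, start_component]⟩
  · exact ⟨j, fun hj => h (by rw [← hj] at hmem ⊢; exact hmem), by rw [← hcomp, finish_component]⟩

/-- A bridge whose ends are joined below the other bridges is the only bridge on its component. -/
theorem bridgeComponent_ne {k j : Letter} (h : B.finish k ∈ B.orbitMu (B.start k)) (hj : j ≠ k) :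
    B.bridgeComponent j ≠ B.bridgeComponent k := by
  have hk := B.gamma_start k
  -- `P` marks the orbit together with the bridge `k`. No strand leaves this set, so it is a union
  -- of components, and it misses every other bridge.
  let P : B.Site → Prop := Sum.elim (fun x => x ∈ B.orbitMu (B.start k)) (fun y => y.1 = k)
  -- Both ends of `k` already use up the two fixed points that the orbit can hold, so no end of
  -- another bridge is in it.
  have uniq : ∀ y, B.gamma y = y → y ∈ B.orbitMu (B.start k) →
      y = B.start k ∨ y = B.finish k := by
    intro y hy hmem
    by_contra! hne
    exact hne.2 (Equiv.Perm.fixed_eq_of_mem_orbit B.gamma_gamma B.phi_phi hk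
      (B.mem_orbitMu.1 hmem) (B.mem_orbitMu.1 h) hy (B.gamma_finish k) hne.1
      (B.start_ne_finish k k).symm)
  have hphi : ∀ x y, B.phi x = y → (x ∈ B.orbitMu (B.start k) ↔ y ∈ B.orbitMu (B.start k)) := by
    rintro x _ rfl
    exact (B.phi_mem_orbitMu hk).symm
  have hstrand : ∀ x y, B.Strand x y → (P x ↔ P y) := by
    intro x y hxy
    cases hxy with
    | bridge i => exact Iff.rfl
    | bridgeStart i =>
      refine ⟨fun hi => ?_, fun hi => ?_⟩
      · rcases uniq _ (B.gamma_start i) hi with h' | h'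
        · exact congrArg Sigma.fst h'
        · exact congrArg Sigma.fst h'
      · change B.start i ∈ B.orbitMu (B.start k)
        rw [show i = k from hi]
        exact B.start_mem_orbitMu k
    | bridgeEnd i =>
      refine ⟨fun hi => ?_, fun hi => ?_⟩
      · rcases uniq _ (B.gamma_finish i) hi with h' | h'
        · exact congrArg Sigma.fst h'
        · exact congrArg Sigma.fst h'
      · change B.finish i ∈ B.orbitMu (B.start k)
        rw [show i = k from hi]
        exact h
    | under i r h0 h1 =>
      rw [B.natCast_two_size_sub i (by omega)]
      exact (B.gamma_mem_orbitMu hk).symm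
    | arcAB r h0 h1 => exact hphi _ _ (B.phi_a_sub r h0 h1).1
    | arcBC r h0 h1 => exact hphi _ _ (B.phi_b_sub r h0 h1).1
    | arcCA r h0 h1 => exact hphi _ _ (B.phiFun_c_sub r h0 h1)
  have hwalk : ∀ {x y : B.Site}, B.link.Walk x y → (P x ↔ P y) := by
    intro x y w
    induction w with
    | nil => exact Iff.rfl
    | cons hadj _ ih =>
      rcases ((SimpleGraph.fromRel_adj _ _ _).1 hadj).2 with h' | h'
      · exact (hstrand _ _ h').trans ih
      · exact (hstrand _ _ h').symm.trans ih
  intro hc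
  obtain ⟨w⟩ := SimpleGraph.ConnectedComponent.exact hc
  exact hj ((hwalk w).2 rfl)

theorem finish_mem_orbitMu_iff (k : Letter) :
    B.finish k ∈ B.orbitMu (B.start k) ↔
      ∀ j, j ≠ k → B.bridgeComponent j ≠ B.bridgeComponent k := by
  refine ⟨fun h j hj => B.bridgeComponent_ne h hj, fun h => ?_⟩
  by_contra hk
  obtain ⟨j, hj, hc⟩ := B.exists_bridgeComponent_eq hk
  exact h j hj hc

/-! ### Counting the components -/

open Classical in
/-- Every component of a Schubert form runs along a bridge. -/
theorem IsSchubertForm.numComponents_eq {B : ThreeButterfly} (hB : B.IsSchubertForm) :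
    B.numComponents =
      ({B.bridgeComponent .a, B.bridgeComponent .b, B.bridgeComponent .c} :
        Finset B.link.ConnectedComponent).card := by
  have h : ∀ K : B.link.ConnectedComponent,
      K ∈ ({B.bridgeComponent .a, B.bridgeComponent .b, B.bridgeComponent .c} :
        Finset B.link.ConnectedComponent) := by
    intro K
    obtain ⟨k, i, rfl⟩ := hB K
    rw [onBridge_component]
    cases k <;> simp
  rw [numComponents, ← Nat.card_eq_finsetCard]
  exact Nat.card_congr (Equiv.subtypeUnivEquiv h).symm

end ThreeButterfly

theorem mainTheorem5 (B : ThreeButterfly) (hB : B.IsSchubertForm) :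
    (B.numComponents = 1 ↔
      B.a B.p ∉ B.orbitMu (B.a 0) ∧ B.b B.q ∉ B.orbitMu (B.b 0) ∧
        B.c B.s ∉ B.orbitMu (B.c 0)) ∧
    (B.numComponents = 2 ↔
      (B.a B.p ∈ B.orbitMu (B.a 0) ∧ B.b B.q ∉ B.orbitMu (B.b 0) ∧
        B.c B.s ∉ B.orbitMu (B.c 0)) ∨
      (B.a B.p ∉ B.orbitMu (B.a 0) ∧ B.b B.q ∈ B.orbitMu (B.b 0) ∧
        B.c B.s ∉ B.orbitMu (B.c 0)) ∨
      (B.a B.p ∉ B.orbitMu (B.a 0) ∧ B.b B.q ∉ B.orbitMu (B.b 0) ∧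
        B.c B.s ∈ B.orbitMu (B.c 0))) ∧
    (B.numComponents = 3 ↔
      B.a B.p ∈ B.orbitMu (B.a 0) ∧ B.b B.q ∈ B.orbitMu (B.b 0) ∧
        B.c B.s ∈ B.orbitMu (B.c 0)) := by
  classical
  have ha := B.finish_mem_orbitMu_iff .a
  have hb := B.finish_mem_orbitMu_iff .b
  have hc := B.finish_mem_orbitMu_iff .c
  have letter : ∀ p : Letter → Prop, (∀ j, p j) ↔ p .a ∧ p .b ∧ p .c := fun p =>
    ⟨fun h => ⟨h _, h _, h _⟩, fun h j => by cases j; exacts [h.1, h.2.1, h.2.2]⟩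
  simp only [letter, ne_eq, reduceCtorEq, not_true_eq_false, not_false_eq_true, false_imp_iff,
    true_imp_iff, true_and, and_true] at ha hb hc
  change B.a B.p ∈ B.orbitMu (B.a 0) ↔ _ at ha
  change B.b B.q ∈ B.orbitMu (B.b 0) ↔ _ at hb
  change B.c B.s ∈ B.orbitMu (B.c 0) ↔ _ at hc
  rw [hB.numComponents_eq, ha, hb, hc]
  -- Only the equalities among the three bridge components matter from here on.
  generalize B.bridgeComponent .a = x
  generalize B.bridgeComponent .b = y
  generalize B.bridgeComponent .c = z
  by_cases hxy : x = y
  · subst hxy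
    by_cases hxz : x = z
    · subst hxz
      simp
    · have hzx : ¬ z = x := fun h => hxz h.symm
      simp [hxz, hzx]
  · have hyx : ¬ y = x := fun h => hxy h.symm
    by_cases hxz : x = z
    · subst hxz
      simp [hxy, hyx]
    · have hzx : ¬ z = x := fun h => hxz h.symm
      by_cases hyz : y = z
      · subst hyz
        simp [hxy, hyx]
      · have hzy : ¬ z = y := fun h => hyz h.symm
        simp [hxy, hyx, hxz, hzx, hyz, hzy]
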